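/- **Theorem.** Let $\mathcal H_1,\mathcal H_2$ be real separable Hilbert spaces and let $\mathcal H=\mathcal H_1\otimes\mathcal H_2$ be their Hilbert tensor product. For $A$ and $B$ Hilbert–Schmidt operators on $\mathcal H_1$ and $\mathcal H_2$, let $A\,\tilde\otimes\,B$ be the bounded operator on $\mathcal H$ with $(A\,\tilde\otimes\,B)(x\otimes y)=Ax\otimes By$, and let $\|\cdot\|_2$ be the Hilbert–Schmidt norm. A separable component decomposition (SCD) of a Hilbert–Schmidt operator $G$ on $\mathcal H$ is an expansion $G=\sum_{i\ge1}\sigma_iA_i\,\tilde\otimes\,B_i$, convergent in $\|\cdot\|_2$, with scores $\sigma_1\ge\sigma_2\ge\cdots\ge0$ and with Hilbert–Schmidt operators $A_i$ on $\mathcal H_1$ and $B_i$ on $\mathcal H_2$ such that $(A_i)_{\sigma_i\neq0}$ and $(B_i)_{\sigma_i\ne0}$ are orthonormal for the Hilbert–Schmidt inner products. Write $\mathrm{DoS}(G)\le R$ if $G$ has an SCD with $\sigma_i=0$ for all $i>R$. Let $X_1,X_2,\dots$ be i.i.d. random elements of $\mathcal H$ with $\mathbb E\|X_1\|^4<\infty$,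 and let the covariance operator $C=\mathbb E[(X_1-\mathbb EX_1)\otimes(X_1-\mathbb EX_1)]$ have SCD $C=\sum_{i\ge1}\sigma_iA_i\,\tilde\otimes\,B_i$. For $N\ge1$ let $\bar X=N^{-1}\sum_{n\le N}X_n$, let $\widehat C_N=N^{-1}\sum_{n\le N}(X_n-\bar X)\otimes(X_n-\bar X)$, and for $R\ge1$ let $\widehat C_{R,N}$ be a best $R$-separable approximation of $\widehat C_N$, that is, a minimizer of $\|\widehat C_N-G\|_2$ over all $G$ with $\mathrm{DoS}(G)\le R$. For every $R\ge1$ such that $\sigma_1>\cdots>\sigma_R>\sigma_{R+1}$, put $\alpha_1=\sigma_1^2-\sigma_2^2$, $\alpha_i=\min\{\sigma_{i-1}^2-\sigma_i^2,\ \sigma_i^2-\sigma_{i+1}^2\}$ for $2\le i\le R$, and $a_R=\|C\|_2\sum_{i=1}^R\sigma_i/\alpha_i$. Then $$\|\widehat C_{R,N}-C\|_2\le\sqrt{\sum_{i=R+1}^\infty\sigma_i^2}+O_{\mathbb P}\!\left(\frac{a_R}{\sqrt N}\right),$$ uniformly in $R$: for every $\varepsilon>0$ there is $M$ such that, for all such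 $R$ and all $N\ge1$, $$\mathbb P\Big(\|\widehat C_{R,N}-C\|_2>\sqrt{\textstyle\sum_{i>R}\sigma_i^2}+M\,a_R/\sqrt N\Big)\le\varepsilon .$$ -/

import Mathlib

open MeasureTheory ProbabilityTheory Filter Topology
open scoped TensorProduct InnerProductSpace

noncomputable section

/-- The Hilbert tensor product `H₁ ⊗ H₂` of real Hilbert spaces: the completion of the algebraic
tensor product under `⟪x₁ ⊗ y₁, x₂ ⊗ y₂⟫ = ⟪x₁, x₂⟫ * ⟪y₁, y₂⟫`. -/
abbrev HilbertTensor (H₁ H₂ : Type*)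
    [NormedAddCommGroup H₁] [InnerProductSpace ℝ H₁]
    [NormedAddCommGroup H₂] [InnerProductSpace ℝ H₂] : Type _ :=
  UniformSpace.Completion (H₁ ⊗[ℝ] H₂)

/-- The elementary tensor `x ⊗ y` in the Hilbert tensor product. -/
def hTmul {H₁ H₂ : Type*}
    [NormedAddCommGroup H₁] [InnerProductSpace ℝ H₁]
    [NormedAddCommGroup H₂] [InnerProductSpace ℝ H₂] (x : H₁) (y : H₂) : HilbertTensor H₁ H₂ :=
  ((x ⊗ₜ[ℝ] y : H₁ ⊗[ℝ] H₂) : UniformSpace.Completion (H₁ ⊗[ℝ] H₂))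

/-- The operator `A ⊗̃ B` on `H₁ ⊗ H₂`: the continuous extension to the completion of
`x ⊗ y ↦ A x ⊗ B y`. -/
def tensorOp {H₁ H₂ : Type*}
    [NormedAddCommGroup H₁] [InnerProductSpace ℝ H₁]
    [NormedAddCommGroup H₂] [InnerProductSpace ℝ H₂] (A : H₁ →L[ℝ] H₁) (B : H₂ →L[ℝ] H₂) :
    HilbertTensor H₁ H₂ →L[ℝ] HilbertTensor H₁ H₂ :=
  ((UniformSpace.Completion.toComplL (𝕜 := ℝ) (E := H₁ ⊗[ℝ] H₂)).comp
    (TensorProduct.mapL A B)).extend (UniformSpace.Completion.toComplL (𝕜 := ℝ) (E := H₁ ⊗[ℝ] H₂))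

theorem tensorOp_hTmul {H₁ H₂ : Type*}
    [NormedAddCommGroup H₁] [InnerProductSpace ℝ H₁]
    [NormedAddCommGroup H₂] [InnerProductSpace ℝ H₂] (A : H₁ →L[ℝ] H₁) (B : H₂ →L[ℝ] H₂)
    (x : H₁) (y : H₂) : tensorOp A B (hTmul x y) = hTmul (A x) (B y) :=
  ContinuousLinearMap.extend_eq
    ((UniformSpace.Completion.toComplL (𝕜 := ℝ) (E := H₁ ⊗[ℝ] H₂)).comp (TensorProduct.mapL A B))
    UniformSpace.Completion.denseRange_coe
    (UniformSpace.Completion.isUniformInducing_coe _) (x ⊗ₜ[ℝ] y)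

/-- The index set of a fixed orthonormal basis of the Hilbert space `H`. -/
def stdHilbertIndex (H : Type*) [NormedAddCommGroup H] [InnerProductSpace ℝ H]
    [CompleteSpace H] : Set H :=
  Classical.choose (exists_hilbertBasis ℝ H)

/-- A fixed orthonormal (Hilbert) basis of the Hilbert space `H`. -/
def stdHilbertBasis (H : Type*) [NormedAddCommGroup H] [InnerProductSpace ℝ H]
    [CompleteSpace H] : HilbertBasis (stdHilbertIndex H) ℝ H :=
  Classical.choose (Classical.choose_spec (exists_hilbertBasis ℝ H))

/-- `F` is a Hilbert-Schmidt operator: `∑ ‖F e_j‖² < ∞` for an orthonormal basis `(e_j)`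
(the choice of the basis is irrelevant, see `isHilbertSchmidt_iff` and `hsNorm_eq`). -/
def IsHilbertSchmidt {H : Type*} [NormedAddCommGroup H] [InnerProductSpace ℝ H]
    [CompleteSpace H] (F : H →L[ℝ] H) : Prop :=
  Summable fun j => ‖F (stdHilbertBasis H j)‖ ^ 2

/-- The Hilbert-Schmidt inner product `⟪F, G⟫ = ∑ ⟪F e_j, G e_j⟫`. -/
def hsInner {H : Type*} [NormedAddCommGroup H] [InnerProductSpace ℝ H]
    [CompleteSpace H] (F G : H →L[ℝ] H) : ℝ :=
  ∑' j, ⟪F (stdHilbertBasis H j), G (stdHilbertBasis H j)⟫_ℝ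

/-- The Hilbert-Schmidt norm `‖F‖₂ = (∑ ‖F e_j‖²)^(1/2)`. -/
def hsNorm {H : Type*} [NormedAddCommGroup H] [InnerProductSpace ℝ H]
    [CompleteSpace H] (F : H →L[ℝ] H) : ℝ :=
  √(∑' j, ‖F (stdHilbertBasis H j)‖ ^ 2)

theorem ofReal_norm_sq_eq_tsum {H ι : Type*} [NormedAddCommGroup H] [InnerProductSpace ℝ H]
    (b : HilbertBasis ι ℝ H) (x : H) :
    ENNReal.ofReal (‖x‖ ^ 2) = ∑' k, ENNReal.ofReal (⟪x, b k⟫_ℝ ^ 2) := by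
  have h : HasSum (fun k => ⟪x, b k⟫_ℝ ^ 2) (‖x‖ ^ 2) := by
    rw [← real_inner_self_eq_norm_sq]
    have e : (fun k => ⟪x, b k⟫_ℝ ^ 2) = fun k => ⟪x, b k⟫_ℝ * ⟪b k, x⟫_ℝ := by
      funext k
      rw [real_inner_comm x (b k), sq]
    rw [e]
    exact b.hasSum_inner_mul_inner x x
  rw [← h.tsum_eq, ENNReal.ofReal_tsum_of_nonneg (fun k => sq_nonneg _) h.summable]

theorem tsum_ofReal_adjoint {H ι κ : Type*} [NormedAddCommGroup H] [InnerProductSpace ℝ H]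
    [CompleteSpace H] (F : H →L[ℝ] H) (b : HilbertBasis ι ℝ H) (c : HilbertBasis κ ℝ H) :
    ∑' i, ENNReal.ofReal (‖F (b i)‖ ^ 2)
      = ∑' j, ENNReal.ofReal (‖ContinuousLinearMap.adjoint F (c j)‖ ^ 2) := by
  simp_rw [fun i => ofReal_norm_sq_eq_tsum c (F (b i)),
    fun j => ofReal_norm_sq_eq_tsum b (ContinuousLinearMap.adjoint F (c j))]
  rw [ENNReal.tsum_comm]
  refine tsum_congr fun j => tsum_congr fun i => ?_
  rw [ContinuousLinearMap.adjoint_inner_left, real_inner_comm]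

theorem summable_iff_tsum_ofReal_ne_top {ι : Type*} (d : ι → ℝ) (hd : ∀ k, 0 ≤ d k) :
    Summable d ↔ ∑' k, ENNReal.ofReal (d k) ≠ ⊤ := by
  refine ⟨fun h => h.tsum_ofReal_ne_top, fun h => ?_⟩
  simpa [ENNReal.toReal_ofReal, hd] using ENNReal.summable_toReal h

theorem tsum_basis_indep {H ι κ : Type*} [NormedAddCommGroup H] [InnerProductSpace ℝ H]
    [CompleteSpace H] (F : H →L[ℝ] H) (b : HilbertBasis ι ℝ H) (c : HilbertBasis κ ℝ H) :
    ∑' i, ENNReal.ofReal (‖F (b i)‖ ^ 2) = ∑' j, ENNReal.ofReal (‖F (c j)‖ ^ 2) := by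
  rw [tsum_ofReal_adjoint F b c, tsum_ofReal_adjoint F c c]

/-- Being Hilbert-Schmidt does not depend on the orthonormal basis. -/
theorem isHilbertSchmidt_iff {H ι : Type*} [NormedAddCommGroup H] [InnerProductSpace ℝ H]
    [CompleteSpace H] (F : H →L[ℝ] H) (b : HilbertBasis ι ℝ H) :
    IsHilbertSchmidt F ↔ Summable fun i => ‖F (b i)‖ ^ 2 := by
  unfold IsHilbertSchmidt
  rw [summable_iff_tsum_ofReal_ne_top _ (fun k => sq_nonneg _),
    summable_iff_tsum_ofReal_ne_top _ (fun k => sq_nonneg _),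
    tsum_basis_indep F (stdHilbertBasis H) b]

/-- The Hilbert-Schmidt norm does not depend on the orthonormal basis. -/
theorem hsNorm_eq {H ι : Type*} [NormedAddCommGroup H] [InnerProductSpace ℝ H]
    [CompleteSpace H] (F : H →L[ℝ] H) (b : HilbertBasis ι ℝ H) :
    hsNorm F = √(∑' i, ‖F (b i)‖ ^ 2) := by
  have h := congrArg ENNReal.toReal (tsum_basis_indep F (stdHilbertBasis H) b)
  rw [ENNReal.tsum_toReal_eq (fun _ => ENNReal.ofReal_ne_top),
    ENNReal.tsum_toReal_eq (fun _ => ENNReal.ofReal_ne_top)] at h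
  simp only [ENNReal.toReal_ofReal (sq_nonneg _)] at h
  rw [hsNorm, h]

/-- `C = ∑ σ_j A_j ⊗̃ B_j` is a separable component decomposition (SCD) of the Hilbert-Schmidt
operator `C` on `H₁ ⊗ H₂`, i.e. a singular value decomposition of `C` seen as an element of
`S₂(H₁) ⊗ S₂(H₂)`: the scores `σ_0 ≥ σ_1 ≥ ⋯ ≥ 0` are nonincreasing and nonnegative, the components
with nonzero score are orthonormal in `S₂(H₁)`, resp. `S₂(H₂)`, and the series converges to `C`
in the Hilbert-Schmidt norm. Components with score zero do not contribute to the sum and are not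
constrained (an orthonormal sequence is too long when `S₂(H₁)` or `S₂(H₂)` is
finite dimensional). -/
structure IsSCD {H₁ H₂ : Type*}
    [NormedAddCommGroup H₁] [InnerProductSpace ℝ H₁] [CompleteSpace H₁]
    [NormedAddCommGroup H₂] [InnerProductSpace ℝ H₂] [CompleteSpace H₂]
    (C : HilbertTensor H₁ H₂ →L[ℝ] HilbertTensor H₁ H₂)
    (σ : ℕ → ℝ) (A : ℕ → H₁ →L[ℝ] H₁) (B : ℕ → H₂ →L[ℝ] H₂) : Prop where
  hilbertSchmidt : IsHilbertSchmidt C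
  nonneg : ∀ j, 0 ≤ σ j
  antitone : Antitone σ
  hilbertSchmidt_left : ∀ j, IsHilbertSchmidt (A j)
  hilbertSchmidt_right : ∀ j, IsHilbertSchmidt (B j)
  inner_left : ∀ i j, σ i ≠ 0 → σ j ≠ 0 → hsInner (A i) (A j) = if i = j then 1 else 0
  inner_right : ∀ i j, σ i ≠ 0 → σ j ≠ 0 → hsInner (B i) (B j) = if i = j then 1 else 0
  tendsto : Tendsto
    (fun n : ℕ => hsNorm (C - ∑ j ∈ Finset.range n, σ j • tensorOp (A j) (B j))) atTop (𝓝 0)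

/-- `DoS(G) ≤ R`: all but (at most) the first `R` separable component scores of `G` vanish. -/
def DoSLE {H₁ H₂ : Type*}
    [NormedAddCommGroup H₁] [InnerProductSpace ℝ H₁] [CompleteSpace H₁]
    [NormedAddCommGroup H₂] [InnerProductSpace ℝ H₂] [CompleteSpace H₂]
    (G : HilbertTensor H₁ H₂ →L[ℝ] HilbertTensor H₁ H₂) (R : ℕ) : Prop :=
  ∃ (σ : ℕ → ℝ) (A : ℕ → H₁ →L[ℝ] H₁) (B : ℕ → H₂ →L[ℝ] H₂),
    IsSCD G σ A B ∧ ∀ j, R ≤ j → σ j = 0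

/-- `G` is a best `R`-separable approximation of `C`: a minimizer of `‖C - G‖₂` subject to
`DoS(G) ≤ R`. -/
def IsBestRSeparable {H₁ H₂ : Type*}
    [NormedAddCommGroup H₁] [InnerProductSpace ℝ H₁] [CompleteSpace H₁]
    [NormedAddCommGroup H₂] [InnerProductSpace ℝ H₂] [CompleteSpace H₂]
    (R : ℕ) (C G : HilbertTensor H₁ H₂ →L[ℝ] HilbertTensor H₁ H₂) : Prop :=
  DoSLE G R ∧ ∀ G' : HilbertTensor H₁ H₂ →L[ℝ] HilbertTensor H₁ H₂,
    DoSLE G' R → hsNorm (C - G) ≤ hsNorm (C - G')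

/-- The covariance operator `E[(X - m) ⊗ (X - m)]`, `m = E X`, of a random element `X` of a Hilbert
space (expectations are Bochner integrals; `x ⊗ x` is the operator `e ↦ ⟪x, e⟫ x`). -/
def covOp {Ω H : Type*} [MeasurableSpace Ω]
    [NormedAddCommGroup H] [InnerProductSpace ℝ H] [CompleteSpace H]
    (μ : Measure Ω) (X : Ω → H) : H →L[ℝ] H :=
  ∫ ω, InnerProductSpace.rankOne ℝ (X ω - ∫ ω', X ω' ∂μ) (X ω - ∫ ω', X ω' ∂μ) ∂μ

/-- The sample mean of `x 0, …, x (N - 1)`. -/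
def sampleMean {H : Type*} [NormedAddCommGroup H] [InnerProductSpace ℝ H]
    (N : ℕ) (x : ℕ → H) : H :=
  (N : ℝ)⁻¹ • ∑ n ∈ Finset.range N, x n

/-- The empirical covariance `N⁻¹ ∑ (x_n - x̄) ⊗ (x_n - x̄)` of `x 0, …, x (N - 1)`. -/
def empCov {H : Type*} [NormedAddCommGroup H] [InnerProductSpace ℝ H]
    (N : ℕ) (x : ℕ → H) : H →L[ℝ] H :=
  (N : ℝ)⁻¹ • ∑ n ∈ Finset.range N,
    InnerProductSpace.rankOne ℝ (x n - sampleMean N x) (x n - sampleMean N x)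

/-- The gap of the squared scores at index `i`. With scores indexed from `0` this is
`min (σ_{i-1}² - σ_i²) (σ_i² - σ_{i+1}²)`, where for the leading score only the second gap is
present. -/
def scoreGap (σ : ℕ → ℝ) : ℕ → ℝ
  | 0 => σ 0 ^ 2 - σ 1 ^ 2
  | i + 1 => min (σ i ^ 2 - σ (i + 1) ^ 2) (σ (i + 1) ^ 2 - σ (i + 2) ^ 2)

/-- The constant `a_R = ‖C‖₂ ∑ σ_i / α_i`, the sum extending over the `R` leading scores. -/
def aConst {H : Type*} [NormedAddCommGroup H] [InnerProductSpace ℝ H] [CompleteSpace H]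
    (C : H →L[ℝ] H) (σ : ℕ → ℝ) (R : ℕ) : ℝ :=
  hsNorm C * ∑ i ∈ Finset.range R, σ i / scoreGap σ i

end

/-! The estimate needs no perturbation theory for the components. Let `D` be the empirical
covariance, `G` its best `R`-separable approximation and `C_R` the truncated SCD of `C`. Since `C_R`
competes with `G`, the triangle inequality gives ‖G - C‖₂ ≤ ‖D - C_R‖₂ + ‖D - C‖₂ ≤ ‖C - C_R‖₂ + 2‖D
- C‖₂, and orthonormality bounds ‖C - C_R‖₂ by the tail of the scores
(`IsSCD.hsNorm_bestRSeparable_sub_le`).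

Two facts remain. The gaps enter only through `a_R ≥ 1` (`IsSCD.one_le_aConst`), so a bound of order
`1/√N` for ‖D - C‖₂ is already enough, and uniformity in `R` is automatic because `D` and `C` do not
involve `R`. That bound (`exists_measure_hsNorm_empCov_sub_le`) comes from computing second moments
entry by entry in an orthonormal basis: each entry is a mean of i.i.d. variables, so its variance
carries a factor `1/N`, and summing over the entries yields the fourth moment of the norm. Markov's
inequality finishes. -/

/-! ### Hilbert–Schmidt norm and rank-one operators. -/

section HilbertSchmidt

variable {H : Type*} [NormedAddCommGroup H] [InnerProductSpace ℝ H] [CompleteSpace H]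

/-- A Hilbert-Schmidt operator as the square summable family of the images of the basis vectors. -/
noncomputable def hsToLp (F : H →L[ℝ] H) (hF : IsHilbertSchmidt F) :
    lp (fun _ : stdHilbertIndex H => H) 2 :=
  ⟨fun j => F (stdHilbertBasis H j), memℓp_gen (by simpa [IsHilbertSchmidt] using hF)⟩

theorem norm_hsToLp (F : H →L[ℝ] H) (hF : IsHilbertSchmidt F) : ‖hsToLp F hF‖ = hsNorm F := by
  rw [lp.norm_eq_tsum_rpow (by norm_num), hsNorm, Real.sqrt_eq_rpow]
  simp [hsToLp]

theorem hsNorm_nonneg (F : H →L[ℝ] H) : 0 ≤ hsNorm F := Real.sqrt_nonneg _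

theorem IsHilbertSchmidt.add {F G : H →L[ℝ] H} (hF : IsHilbertSchmidt F)
    (hG : IsHilbertSchmidt G) : IsHilbertSchmidt (F + G) := by
  have h := (lp.memℓp (hsToLp F hF + hsToLp G hG)).summable (by simp)
  simp only [lp.coeFn_add, Pi.add_apply, ENNReal.toReal_ofNat, Real.rpow_ofNat] at h
  exact h

theorem IsHilbertSchmidt.smul {F : H →L[ℝ] H} (hF : IsHilbertSchmidt F) (c : ℝ) :
    IsHilbertSchmidt (c • F) := by
  simpa [IsHilbertSchmidt, hsToLp, norm_smul] using
    (lp.memℓp (c • hsToLp F hF)).summable (by simp)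

theorem IsHilbertSchmidt.neg {F : H →L[ℝ] H} (hF : IsHilbertSchmidt F) :
    IsHilbertSchmidt (-F) := by
  simpa using hF.smul (-1)

theorem IsHilbertSchmidt.sub {F G : H →L[ℝ] H} (hF : IsHilbertSchmidt F)
    (hG : IsHilbertSchmidt G) : IsHilbertSchmidt (F - G) := by
  simpa [sub_eq_add_neg] using hF.add hG.neg

theorem isHilbertSchmidt_zero : IsHilbertSchmidt (0 : H →L[ℝ] H) := by
  simp [IsHilbertSchmidt, summable_zero]

theorem isHilbertSchmidt_sum {κ : Type*} (s : Finset κ) (F : κ → H →L[ℝ] H)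
    (hF : ∀ k, IsHilbertSchmidt (F k)) : IsHilbertSchmidt (∑ k ∈ s, F k) :=
  Finset.sum_induction F IsHilbertSchmidt (fun _ _ => .add) isHilbertSchmidt_zero fun k _ => hF k

theorem hsNorm_add_le {F G : H →L[ℝ] H} (hF : IsHilbertSchmidt F) (hG : IsHilbertSchmidt G) :
    hsNorm (F + G) ≤ hsNorm F + hsNorm G := by
  rw [← norm_hsToLp F hF, ← norm_hsToLp G hG, ← norm_hsToLp _ (hF.add hG)]
  exact norm_add_le (hsToLp F hF) (hsToLp G hG)

theorem hsNorm_neg (F : H →L[ℝ] H) : hsNorm (-F) = hsNorm F := by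
  simp [hsNorm]

theorem hsNorm_sub_comm (F G : H →L[ℝ] H) : hsNorm (F - G) = hsNorm (G - F) := by
  rw [← hsNorm_neg, neg_sub]

theorem hsNorm_sub_le {F G K : H →L[ℝ] H} (hF : IsHilbertSchmidt F) (hG : IsHilbertSchmidt G)
    (hK : IsHilbertSchmidt K) : hsNorm (F - K) ≤ hsNorm (F - G) + hsNorm (G - K) := by
  simpa using hsNorm_add_le (hF.sub hG) (hG.sub hK)

theorem hsNorm_le_add_hsNorm_sub {F G : H →L[ℝ] H} (hF : IsHilbertSchmidt F)
    (hG : IsHilbertSchmidt G) : hsNorm F ≤ hsNorm G + hsNorm (F - G) := by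
  simpa using hsNorm_add_le hG (hF.sub hG)

theorem hsNorm_sq {ι : Type*} (F : H →L[ℝ] H) (b : HilbertBasis ι ℝ H) :
    hsNorm F ^ 2 = ∑' i, ‖F (b i)‖ ^ 2 := by
  rw [hsNorm_eq F b, Real.sq_sqrt (tsum_nonneg fun _ => sq_nonneg _)]

/-- Parseval, in `ENNReal` so that the double sum over matrix entries can later be exchanged with
integrals without summability conditions. -/
theorem ofReal_hsNorm_sq {ι : Type*} {F : H →L[ℝ] H} (hF : IsHilbertSchmidt F)
    (b : HilbertBasis ι ℝ H) :
    ENNReal.ofReal (hsNorm F ^ 2) = ∑' i, ∑' j, ENNReal.ofReal (⟪F (b i), b j⟫_ℝ ^ 2) := by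
  rw [hsNorm_sq F b, ENNReal.ofReal_tsum_of_nonneg (fun _ => sq_nonneg _)
    ((isHilbertSchmidt_iff F b).1 hF)]
  exact tsum_congr fun i => ofReal_norm_sq_eq_tsum b _

theorem hasSum_norm_sq_rankOne {H ι : Type*} [NormedAddCommGroup H] [InnerProductSpace ℝ H]
    (b : HilbertBasis ι ℝ H) (x : H) :
    HasSum (fun i => ‖InnerProductSpace.rankOne ℝ x x (b i)‖ ^ 2) ((‖x‖ ^ 2) ^ 2) := by
  have h := (b.hasSum_inner_mul_inner x x).mul_right (‖x‖ ^ 2)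
  rw [real_inner_self_eq_norm_sq, ← sq] at h
  convert! h using 2 with i
  rw [InnerProductSpace.rankOne_apply, norm_smul, mul_pow, Real.norm_eq_abs, sq_abs,
    real_inner_comm x (b i), sq]

theorem isHilbertSchmidt_rankOne (x : H) : IsHilbertSchmidt (InnerProductSpace.rankOne ℝ x x) :=
  (hasSum_norm_sq_rankOne (stdHilbertBasis H) x).summable

theorem hsNorm_rankOne (x : H) : hsNorm (InnerProductSpace.rankOne ℝ x x) = ‖x‖ ^ 2 := by
  rw [hsNorm, (hasSum_norm_sq_rankOne (stdHilbertBasis H) x).tsum_eq,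
    Real.sqrt_sq (by positivity)]

theorem isHilbertSchmidt_empCov (N : ℕ) (x : ℕ → H) : IsHilbertSchmidt (empCov N x) :=
  (isHilbertSchmidt_sum _ _ fun _ => isHilbertSchmidt_rankOne _).smul _

theorem hasSum_hsInner {F G : H →L[ℝ] H} (hF : IsHilbertSchmidt F) (hG : IsHilbertSchmidt G) :
    HasSum (fun j => ⟪F (stdHilbertBasis H j), G (stdHilbertBasis H j)⟫_ℝ) (hsInner F G) :=
  (lp.summable_inner (𝕜 := ℝ) (hsToLp F hF) (hsToLp G hG)).hasSum

/-- Distinct basis vectors are at distance √2, so balls of radius 1/2 around them are disjoint.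
Countability is what permits exchanging coordinate sums with integrals. -/
theorem HilbertBasis.countable {H ι : Type*} [NormedAddCommGroup H] [InnerProductSpace ℝ H]
    [TopologicalSpace.SeparableSpace H]
    (b : HilbertBasis ι ℝ H) : Countable ι := by
  refine Pairwise.countable_of_isOpen_disjoint (s := fun i => Metric.ball (b i) (1 / 2))
    (fun i j hij => Metric.ball_disjoint_ball ?_) (fun i => Metric.isOpen_ball)
    fun i => ⟨b i, Metric.mem_ball_self (by norm_num)⟩
  have h : dist (b i) (b j) ^ 2 = 2 := by
    rw [dist_eq_norm, norm_sub_sq_real, b.orthonormal.1, b.orthonormal.1, b.orthonormal.2 hij]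
    norm_num
  nlinarith [dist_nonneg (x := b i) (y := b j)]

end HilbertSchmidt

/-! ### Product bases of the Hilbert tensor product. -/

section TensorProduct

variable {H₁ H₂ : Type*} [NormedAddCommGroup H₁] [InnerProductSpace ℝ H₁]
  [NormedAddCommGroup H₂] [InnerProductSpace ℝ H₂]

theorem inner_hTmul (x x' : H₁) (y y' : H₂) :
    ⟪hTmul x y, hTmul x' y'⟫_ℝ = ⟪x, x'⟫_ℝ * ⟪y, y'⟫_ℝ := by
  simp [hTmul]

/-- The map `(x, y) ↦ x ⊗ y` into the Hilbert tensor product as a continuous bilinear map. -/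
noncomputable def hTmulL : H₁ →L[ℝ] H₂ →L[ℝ] HilbertTensor H₁ H₂ :=
  (ContinuousLinearMap.compL ℝ H₂ (H₁ ⊗[ℝ] H₂) (HilbertTensor H₁ H₂)
    UniformSpace.Completion.toComplL).comp (TensorProduct.mkL ℝ H₁ H₂)

variable {ι₁ ι₂ : Type*} (b : HilbertBasis ι₁ ℝ H₁) (c : HilbertBasis ι₂ ℝ H₂)

theorem orthonormal_hTmul : Orthonormal ℝ fun p : ι₁ × ι₂ => hTmul (b p.1) (c p.2) := by
  classical
  rw [orthonormal_iff_ite]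
  rintro ⟨i, j⟩ ⟨i', j'⟩
  rw [inner_hTmul, orthonormal_iff_ite.1 b.orthonormal, orthonormal_iff_ite.1 c.orthonormal]
  simp only [Prod.ext_iff, ite_and, mul_ite, mul_one, mul_zero]
  split_ifs <;> rfl

/-- A closed subspace pulls back to a closed subspace under `x ⊗ y` with one factor fixed, so
density passes from the basis vectors to all vectors one factor at a time. Linearity and completion
do the rest. -/
theorem span_hTmul_dense :
    ⊤ ≤ (Submodule.span ℝ (Set.range fun p : ι₁ × ι₂ =>
      hTmul (b p.1) (c p.2))).topologicalClosure := by
  set S := (Submodule.span ℝ (Set.range fun p : ι₁ × ι₂ =>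
    hTmul (b p.1) (c p.2))).topologicalClosure with hS
  have hclosed : IsClosed (S : Set (HilbertTensor H₁ H₂)) :=
    Submodule.isClosed_topologicalClosure _
  have step : ∀ i y, hTmul (b i) y ∈ S := by
    intro i y
    have h : (Submodule.span ℝ (Set.range c)).topologicalClosure ≤
        S.comap (hTmulL (b i)).toLinearMap := by
      refine Submodule.topologicalClosure_minimal _ (Submodule.span_le.2 ?_)
        (hclosed.preimage (hTmulL (b i)).continuous)
      rintro _ ⟨j, rfl⟩
      exact Submodule.le_topologicalClosure _ (Submodule.subset_span ⟨(i, j), rfl⟩)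
    rw [c.dense_span] at h
    exact h (Submodule.mem_top (x := y))
  have step2 : ∀ x y, hTmul x y ∈ S := by
    intro x y
    have h : (Submodule.span ℝ (Set.range b)).topologicalClosure ≤
        S.comap (hTmulL.flip y).toLinearMap := by
      refine Submodule.topologicalClosure_minimal _ (Submodule.span_le.2 ?_)
        (hclosed.preimage (hTmulL.flip y).continuous)
      rintro _ ⟨i, rfl⟩
      exact step i y
    rw [b.dense_span] at h
    exact h (Submodule.mem_top (x := x))
  rintro z -
  refine UniformSpace.Completion.induction_on z hclosed fun t => ?_
  induction t with
  | zero => exact UniformSpace.Completion.coe_zero (α := H₁ ⊗[ℝ] H₂) ▸ S.zero_mem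
  | tmul x y => exact step2 x y
  | add u v hu hv => exact UniformSpace.Completion.coe_add u v ▸ S.add_mem hu hv

/-- The product of two Hilbert bases is a Hilbert basis of the Hilbert tensor product. -/
noncomputable def hTmulBasis : HilbertBasis (ι₁ × ι₂) ℝ (HilbertTensor H₁ H₂) :=
  HilbertBasis.mk (orthonormal_hTmul b c) (span_hTmul_dense b c)

theorem hTmulBasis_apply (p : ι₁ × ι₂) : hTmulBasis b c p = hTmul (b p.1) (c p.2) := by
  simp [hTmulBasis]

end TensorProduct

/-! ### Truncation of an SCD and the deterministic error bound. -/

section SCD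

variable {H₁ H₂ : Type*}
  [NormedAddCommGroup H₁] [InnerProductSpace ℝ H₁] [CompleteSpace H₁]
  [NormedAddCommGroup H₂] [InnerProductSpace ℝ H₂] [CompleteSpace H₂]

/-- The product of the fixed orthonormal bases of `H₁` and `H₂`. -/
noncomputable def stdTensorBasis (H₁ H₂ : Type*)
    [NormedAddCommGroup H₁] [InnerProductSpace ℝ H₁] [CompleteSpace H₁]
    [NormedAddCommGroup H₂] [InnerProductSpace ℝ H₂] [CompleteSpace H₂] :
    HilbertBasis (stdHilbertIndex H₁ × stdHilbertIndex H₂) ℝ (HilbertTensor H₁ H₂) :=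
  hTmulBasis (stdHilbertBasis H₁) (stdHilbertBasis H₂)

theorem tensorOp_stdTensorBasis (A : H₁ →L[ℝ] H₁) (B : H₂ →L[ℝ] H₂)
    (p : stdHilbertIndex H₁ × stdHilbertIndex H₂) :
    tensorOp A B (stdTensorBasis H₁ H₂ p)
      = hTmul (A (stdHilbertBasis H₁ p.1)) (B (stdHilbertBasis H₂ p.2)) := by
  rw [stdTensorBasis, hTmulBasis_apply, tensorOp_hTmul]

/-- On the product basis the inner product factors, and absolute summability of both factors lets
the two sums be multiplied. -/
theorem hasSum_inner_tensorOp {A A' : H₁ →L[ℝ] H₁} {B B' : H₂ →L[ℝ] H₂}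
    (hA : IsHilbertSchmidt A) (hA' : IsHilbertSchmidt A')
    (hB : IsHilbertSchmidt B) (hB' : IsHilbertSchmidt B') :
    HasSum (fun p => ⟪tensorOp A B (stdTensorBasis H₁ H₂ p),
      tensorOp A' B' (stdTensorBasis H₁ H₂ p)⟫_ℝ) (hsInner A A' * hsInner B B') := by
  have h₁ := hasSum_hsInner hA hA'
  have h₂ := hasSum_hsInner hB hB'
  have hs := summable_mul_of_summable_norm h₁.summable.norm h₂.summable.norm
  refine (h₁.mul h₂ hs).congr_fun fun p => ?_
  rw [tensorOp_stdTensorBasis, tensorOp_stdTensorBasis, inner_hTmul]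

theorem IsHilbertSchmidt.tensorOp {A : H₁ →L[ℝ] H₁} {B : H₂ →L[ℝ] H₂}
    (hA : IsHilbertSchmidt A) (hB : IsHilbertSchmidt B) : IsHilbertSchmidt (tensorOp A B) := by
  rw [isHilbertSchmidt_iff _ (stdTensorBasis H₁ H₂)]
  simpa only [real_inner_self_eq_norm_sq] using (hasSum_inner_tensorOp hA hA hB hB).summable

theorem hsNorm_sq_sum_tensorOp (s : Finset ℕ) (σ : ℕ → ℝ) {A : ℕ → H₁ →L[ℝ] H₁}
    {B : ℕ → H₂ →L[ℝ] H₂} (hA : ∀ j, IsHilbertSchmidt (A j)) (hB : ∀ j, IsHilbertSchmidt (B j)) :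
    hsNorm (∑ j ∈ s, σ j • tensorOp (A j) (B j)) ^ 2
      = ∑ i ∈ s, ∑ j ∈ s, σ i * (σ j * (hsInner (A i) (A j) * hsInner (B i) (B j))) := by
  have h := hasSum_sum (s := s) fun i _ => hasSum_sum (s := s) fun j _ =>
    ((hasSum_inner_tensorOp (hA i) (hA j) (hB i) (hB j)).mul_left (σ j)).mul_left (σ i)
  rw [hsNorm_sq _ (stdTensorBasis H₁ H₂), ← h.tsum_eq]
  refine tsum_congr fun p => ?_
  rw [← real_inner_self_eq_norm_sq]
  simp only [sum_apply, smul_apply, sum_inner, inner_sum,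
    real_inner_smul_left, real_inner_smul_right]
  rw [Finset.sum_comm]
  refine Finset.sum_congr rfl fun i _ => Finset.sum_congr rfl fun j _ => ?_
  ring

namespace IsSCD

variable {C : HilbertTensor H₁ H₂ →L[ℝ] HilbertTensor H₁ H₂} {σ : ℕ → ℝ} {A : ℕ → H₁ →L[ℝ] H₁}
  {B : ℕ → H₂ →L[ℝ] H₂}

theorem isHilbertSchmidt_sum (h : IsSCD C σ A B) (s : Finset ℕ) :
    IsHilbertSchmidt (∑ j ∈ s, σ j • tensorOp (A j) (B j)) :=
  _root_.isHilbertSchmidt_sum _ _ fun j =>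
    ((h.hilbertSchmidt_left j).tensorOp (h.hilbertSchmidt_right j)).smul _

theorem hsNorm_sum (h : IsSCD C σ A B) (s : Finset ℕ) :
    hsNorm (∑ j ∈ s, σ j • tensorOp (A j) (B j)) = √(∑ j ∈ s, σ j ^ 2) := by
  rw [← Real.sqrt_sq (hsNorm_nonneg _),
    hsNorm_sq_sum_tensorOp s σ h.hilbertSchmidt_left h.hilbertSchmidt_right]
  congr 1
  refine Finset.sum_congr rfl fun i hi => ?_
  rw [Finset.sum_eq_single_of_mem i hi]
  -- Orthonormality is available only for nonzero scores; the other terms vanish through their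
  -- coefficient.
  · by_cases h0 : σ i = 0
    · simp [h0]
    · rw [h.inner_left i i h0 h0, h.inner_right i i h0 h0]
      simp [sq]
  · intro j _ hij
    by_cases hi0 : σ i = 0
    · simp [hi0]
    by_cases hj0 : σ j = 0
    · simp [hj0]
    rw [h.inner_left i j hi0 hj0, if_neg hij.symm]
    simp

/-- A Bessel inequality: the norms of the partial sums increase, and the partial sums approach `C`.
-/
theorem sqrt_sum_sq_le (h : IsSCD C σ A B) (n : ℕ) :
    √(∑ j ∈ Finset.range n, σ j ^ 2) ≤ hsNorm C := by
  have ht := (h.tendsto.const_add (hsNorm C))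
  rw [add_zero] at ht
  refine ge_of_tendsto ht (eventually_atTop.2 ⟨n, fun m hm => ?_⟩)
  calc √(∑ j ∈ Finset.range n, σ j ^ 2) ≤ √(∑ j ∈ Finset.range m, σ j ^ 2) :=
        Real.sqrt_le_sqrt (Finset.sum_le_sum_of_subset_of_nonneg
          (Finset.range_subset_range.2 hm) fun _ _ _ => sq_nonneg _)
    _ = hsNorm (∑ j ∈ Finset.range m, σ j • tensorOp (A j) (B j)) := (h.hsNorm_sum _).symm
    _ ≤ _ := by
      rw [hsNorm_sub_comm]
      exact hsNorm_le_add_hsNorm_sub (h.isHilbertSchmidt_sum _) h.hilbertSchmidt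

theorem summable_sq (h : IsSCD C σ A B) : Summable fun j => σ j ^ 2 :=
  summable_of_sum_range_le (fun _ => sq_nonneg _) fun n =>
    (Real.sqrt_le_left (hsNorm_nonneg _)).1 (h.sqrt_sum_sq_le n)

theorem score_zero_le (h : IsSCD C σ A B) : σ 0 ≤ hsNorm C := by
  simpa [Real.sqrt_sq (h.nonneg 0)] using h.sqrt_sum_sq_le 1

/-- Pythagoras for the finite block from `R` to `m`, followed by the limit in `m`. Only this
direction of the identity is needed. -/
theorem hsNorm_sub_sum_range_le (h : IsSCD C σ A B) (R : ℕ) :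
    hsNorm (C - ∑ j ∈ Finset.range R, σ j • tensorOp (A j) (B j))
      ≤ √(∑' i : ℕ, σ (R + i) ^ 2) := by
  have ht := (h.tendsto.add_const (√(∑' i : ℕ, σ (R + i) ^ 2)))
  rw [zero_add] at ht
  refine ge_of_tendsto ht (eventually_atTop.2 ⟨R, fun m hm => ?_⟩)
  refine (hsNorm_sub_le h.hilbertSchmidt (h.isHilbertSchmidt_sum (Finset.range m))
    (h.isHilbertSchmidt_sum _)).trans ?_
  gcongr
  rw [← Finset.sum_Ico_eq_sub _ hm, h.hsNorm_sum]
  refine Real.sqrt_le_sqrt ?_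
  rw [Finset.sum_Ico_eq_sum_range]
  have hs : Summable fun i => σ (R + i) ^ 2 := by
    simpa only [add_comm R] using (summable_nat_add_iff R).2 h.summable_sq
  exact hs.sum_le_tsum _ fun _ _ => sq_nonneg _

theorem doSLE_sum_range (h : IsSCD C σ A B) (R : ℕ) :
    DoSLE (∑ j ∈ Finset.range R, σ j • tensorOp (A j) (B j)) R := by
  -- The components are kept unchanged: once their scores are zero, nothing is required of their
  -- inner products.
  refine ⟨fun j => if j < R then σ j else 0, A, B, ?_, fun j hj => if_neg hj.not_gt⟩
  refine ⟨h.isHilbertSchmidt_sum _, fun j => ?_, fun i j hij => ?_, h.hilbertSchmidt_left,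
    h.hilbertSchmidt_right, fun i j hi hj => ?_, fun i j hi hj => ?_, ?_⟩
  · split_ifs
    exacts [h.nonneg j, le_rfl]
  · split_ifs
    · exact h.antitone hij
    · omega
    · exact h.nonneg i
    · exact le_rfl
  · exact h.inner_left i j (fun h0 => hi (by simp [h0])) fun h0 => hj (by simp [h0])
  · exact h.inner_right i j (fun h0 => hi (by simp [h0])) fun h0 => hj (by simp [h0])
  · refine tendsto_const_nhds.congr' (eventually_atTop.2 ⟨R, fun m hm => ?_⟩)
    have : ∑ j ∈ Finset.range m, (if j < R then σ j else 0) • tensorOp (A j) (B j)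
        = ∑ j ∈ Finset.range R, σ j • tensorOp (A j) (B j) := by
      simp only [ite_smul, zero_smul, ← Finset.sum_filter]
      congr 1
      ext j
      simp only [Finset.mem_filter, Finset.mem_range]
      omega
    beta_reduce
    rw [this, sub_self]
    simp [hsNorm]

/-- A best `R`-separable approximation of `D` approximates `C` up to the tail of the scores of `C`
and twice the distance between `C` and `D`. -/
theorem hsNorm_bestRSeparable_sub_le (h : IsSCD C σ A B)
    {D G : HilbertTensor H₁ H₂ →L[ℝ] HilbertTensor H₁ H₂} (hD : IsHilbertSchmidt D) {R : ℕ}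
    (hG : IsBestRSeparable R D G) :
    hsNorm (G - C) ≤ √(∑' i : ℕ, σ (R + i) ^ 2) + 2 * hsNorm (D - C) := by
  obtain ⟨⟨τ, A', B', hG', -⟩, hmin⟩ := hG
  -- `D` is the intermediate point twice over: from `G` to `C`, and, after minimality, `C` lies
  -- between `D` and the truncation. This is the source of the factor 2.
  have h₁ := hsNorm_sub_le hG'.hilbertSchmidt hD h.hilbertSchmidt
  have h₂ := hmin _ (h.doSLE_sum_range R)
  have h₃ := hsNorm_sub_le hD h.hilbertSchmidt (h.isHilbertSchmidt_sum (Finset.range R))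
  have h₄ := h.hsNorm_sub_sum_range_le R
  rw [hsNorm_sub_comm G D] at h₁
  linarith

theorem scoreGap_pos (h : IsSCD C σ A B) {R : ℕ} (hR : ∀ i < R, σ (i + 1) < σ i) {i : ℕ}
    (hi : i < R) : 0 < scoreGap σ i := by
  have key : ∀ i < R, 0 < σ i ^ 2 - σ (i + 1) ^ 2 := fun i hi =>
    sub_pos.2 (pow_lt_pow_left₀ (hR i hi) (h.nonneg _) two_ne_zero)
  cases i with
  | zero => exact key 0 hi
  | succ i => exact lt_min (key i (by omega)) (key (i + 1) hi)

/-- The leading term suffices: ‖C‖₂ ≥ σ₀ and σ₀² / (σ₀² - σ₁²) ≥ 1, while the remaining terms are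
nonnegative. -/
theorem one_le_aConst (h : IsSCD C σ A B) {R : ℕ} (hR1 : 1 ≤ R)
    (hR : ∀ i < R, σ (i + 1) < σ i) : 1 ≤ aConst C σ R := by
  have h0 : 0 < σ 0 := (h.nonneg 1).trans_lt (hR 0 hR1)
  have hgap := h.scoreGap_pos hR (i := 0) hR1
  have hC := h.score_zero_le
  have h₁ : σ 0 / scoreGap σ 0 ≤ ∑ i ∈ Finset.range R, σ i / scoreGap σ i :=
    Finset.single_le_sum (f := fun i => σ i / scoreGap σ i)
      (fun i hi => div_nonneg (h.nonneg i) (h.scoreGap_pos hR (Finset.mem_range.1 hi)).le)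
      (Finset.mem_range.2 hR1)
  have h₂ : 1 ≤ σ 0 * (σ 0 / scoreGap σ 0) := by
    rw [← mul_div_assoc, one_le_div hgap, scoreGap]
    nlinarith [sq_nonneg (σ 1)]
  exact h₂.trans (mul_le_mul hC h₁ (div_nonneg h0.le hgap.le) (hsNorm_nonneg _))

end IsSCD

end SCD

/-! ### Variance of i.i.d. means. -/

section Probability

variable {Ω : Type*} [MeasurableSpace Ω] {μ : Measure Ω} [IsProbabilityMeasure μ]

/-- The left side is the variance of the mean, which is `1/N` times a single variance by pairwise
independence; the variance is at most the second moment. -/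
theorem lintegral_sq_mean_sub_integral_le {E : Type*} [MeasurableSpace E] {X : ℕ → Ω → E}
    (hindep : iIndepFun X μ) (hident : ∀ n, IdentDistrib (X n) (X 0) μ μ) {f : E → ℝ}
    (hf : Measurable f) (hf2 : MemLp (fun ω => f (X 0 ω)) 2 μ) {N : ℕ} (hN : 1 ≤ N) :
    ∫⁻ ω, ENNReal.ofReal
        (((N : ℝ)⁻¹ * ∑ n ∈ Finset.range N, f (X n ω) - ∫ ω', f (X 0 ω') ∂μ) ^ 2) ∂μ
      ≤ ENNReal.ofReal (N : ℝ)⁻¹ * ∫⁻ ω, ENNReal.ofReal (f (X 0 ω) ^ 2) ∂μ := by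
  have hN0 : (N : ℝ) ≠ 0 := by positivity
  have hid : ∀ n, IdentDistrib (f ∘ X n) (f ∘ X 0) μ μ := fun n => (hident n).comp hf
  have hL : ∀ n, MemLp (f ∘ X n) 2 μ := fun n => (hid n).memLp_iff.2 hf2
  have hmean : ∫ ω, (N : ℝ)⁻¹ * (∑ n ∈ Finset.range N, f ∘ X n) ω ∂μ = ∫ ω', f (X 0 ω') ∂μ := by
    simp only [Finset.sum_apply]
    rw [integral_const_mul, integral_finsetSum _ fun n _ => (hL n).integrable (by simp),
      Finset.sum_congr rfl fun n _ => (hid n).integral_eq]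
    simp [hN0]
  have hvar : variance (fun ω => (N : ℝ)⁻¹ * (∑ n ∈ Finset.range N, f ∘ X n) ω) μ
      = (N : ℝ)⁻¹ * variance (f ∘ X 0) μ := by
    rw [variance_const_mul, IndepFun.variance_sum (fun n _ => hL n)
      (fun i _ j _ hij => (hindep.indepFun hij).comp hf hf),
      Finset.sum_congr rfl fun n _ => (hid n).variance_eq]
    simp only [Finset.sum_const, Finset.card_range, nsmul_eq_mul]
    field_simp
  have hW : MemLp (fun ω => (N : ℝ)⁻¹ * (∑ n ∈ Finset.range N, f ∘ X n) ω) 2 μ :=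
    (memLp_finsetSum' _ fun n _ => hL n).const_mul _
  calc _ = evariance (fun ω => (N : ℝ)⁻¹ * (∑ n ∈ Finset.range N, f ∘ X n) ω) μ := by
        rw [evariance_eq_lintegral_ofReal, hmean]
        simp
    _ = ENNReal.ofReal (N : ℝ)⁻¹ * ENNReal.ofReal (variance (f ∘ X 0) μ) := by
        rw [← ofReal_variance hW, hvar, ENNReal.ofReal_mul (by positivity)]
    _ ≤ _ := by
        gcongr
        rw [← ofReal_integral_eq_lintegral_ofReal hf2.integrable_sq
          (ae_of_all _ fun _ => sq_nonneg _)]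
        exact ENNReal.ofReal_le_ofReal (variance_le_expectation_sq hf2.aestronglyMeasurable)

/-! ### Algebra of the empirical covariance and entries of the covariance operator. -/

variable {H : Type*} [NormedAddCommGroup H] [InnerProductSpace ℝ H]

theorem sampleMean_sub {N : ℕ} (hN : 1 ≤ N) (x : ℕ → H) (m : H) :
    sampleMean N x - m = (N : ℝ)⁻¹ • ∑ n ∈ Finset.range N, (x n - m) := by
  have hN0 : (N : ℝ) ≠ 0 := by positivity
  rw [Finset.sum_sub_distrib, smul_sub, sampleMean]
  simp [← Nat.cast_smul_eq_nsmul ℝ, smul_smul, hN0]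

/-- The empirical covariance in terms of deviations from an arbitrary centre. -/
theorem empCov_eq {N : ℕ} (hN : 1 ≤ N) (x : ℕ → H) (m : H) :
    empCov N x = (N : ℝ)⁻¹ • ∑ n ∈ Finset.range N, InnerProductSpace.rankOne ℝ (x n - m) (x n - m)
      - InnerProductSpace.rankOne ℝ (sampleMean N x - m) (sampleMean N x - m) := by
  have hN0 : (N : ℝ) ≠ 0 := by positivity
  have hs := sampleMean_sub hN x m
  set d := sampleMean N x - m with hd
  have hsum : ∑ n ∈ Finset.range N, (x n - m) = (N : ℝ) • d := by
    rw [hs, smul_smul, mul_inv_cancel₀ hN0, one_smul]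
  have hx : ∀ n, x n - sampleMean N x = (x n - m) - d := fun n => by rw [hd]; abel
  -- From here `d` is an arbitrary vector tied to the sample only by `hsum`; the identity is then
  -- bilinear algebra.
  clear_value d
  ext v
  simp only [empCov, hx, smul_apply, sum_apply, sub_apply, InnerProductSpace.rankOne_apply]
  have hterm : ∀ n, ⟪x n - m - d, v⟫_ℝ • (x n - m - d)
      = ⟪x n - m, v⟫_ℝ • (x n - m) - ⟪x n - m, v⟫_ℝ • d - ⟪d, v⟫_ℝ • (x n - m)
        + ⟪d, v⟫_ℝ • d := fun n => by
    rw [inner_sub_left (x n - m) d v]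
    module
  simp only [hterm]
  rw [Finset.sum_add_distrib, Finset.sum_sub_distrib, Finset.sum_sub_distrib, ← Finset.sum_smul,
    ← Finset.smul_sum, ← sum_inner, hsum, real_inner_smul_left, Finset.sum_const,
    Finset.card_range, ← Nat.cast_smul_eq_nsmul ℝ]
  match_scalars <;> field_simp
  ring

variable [CompleteSpace H]

-- The rank-one operator has norm equal to the squared norm of its vector, so a second moment makes
-- it Bochner integrable, and evaluation and inner product pass under the integral.
omit [IsProbabilityMeasure μ] in
theorem inner_covOp_apply {X : Ω → H}
    (hX : MemLp (fun ω => X ω - ∫ ω', X ω' ∂μ) 2 μ) (u v : H) :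
    ⟪covOp μ X u, v⟫_ℝ
      = ∫ ω, ⟪X ω - ∫ ω', X ω' ∂μ, u⟫_ℝ * ⟪X ω - ∫ ω', X ω' ∂μ, v⟫_ℝ ∂μ := by
  have hint : Integrable (fun ω => InnerProductSpace.rankOne ℝ
      (X ω - ∫ ω', X ω' ∂μ) (X ω - ∫ ω', X ω' ∂μ)) μ := by
    have hcont : Continuous fun x : H => InnerProductSpace.rankOne ℝ x x :=
      (ContinuousLinearMap.smulRightL ℝ H H).continuous₂.comp
        ((innerSL ℝ).continuous.prodMk continuous_id)
    refine (hX.integrable_norm_pow two_ne_zero).mono'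
      (hcont.comp_aestronglyMeasurable hX.aestronglyMeasurable) (ae_of_all _ fun ω => ?_)
    rw [InnerProductSpace.norm_rankOne, sq]
  rw [covOp, ContinuousLinearMap.integral_apply hint, real_inner_comm, ← integral_inner]
  · refine integral_congr_ae (ae_of_all _ fun ω => ?_)
    simp only [InnerProductSpace.rankOne_apply, real_inner_smul_right]
    rw [real_inner_comm v]
  · exact (ContinuousLinearMap.apply ℝ H u).integrable_comp hint

/-- The deviation of the mean of the squares `(x_n - m) ⊗ (x_n - m)` from an operator. -/
noncomputable def centeredDeviation (C : H →L[ℝ] H) (m : H) (N : ℕ) (x : ℕ → H) : H →L[ℝ] H :=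
  (N : ℝ)⁻¹ • ∑ n ∈ Finset.range N, InnerProductSpace.rankOne ℝ (x n - m) (x n - m) - C

theorem isHilbertSchmidt_centeredDeviation {C : H →L[ℝ] H} (hC : IsHilbertSchmidt C) (m : H)
    (N : ℕ) (x : ℕ → H) : IsHilbertSchmidt (centeredDeviation C m N x) :=
  ((isHilbertSchmidt_sum _ _ fun _ => isHilbertSchmidt_rankOne _).smul _).sub hC

omit [CompleteSpace H] in
theorem inner_centeredDeviation (C : H →L[ℝ] H) (m : H) (N : ℕ) (x : ℕ → H) (u v : H) :
    ⟪centeredDeviation C m N x u, v⟫_ℝ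
      = (N : ℝ)⁻¹ * ∑ n ∈ Finset.range N, ⟪x n - m, u⟫_ℝ * ⟪x n - m, v⟫_ℝ - ⟪C u, v⟫_ℝ := by
  simp only [centeredDeviation, sub_apply, smul_apply, sum_apply, InnerProductSpace.rankOne_apply]
  rw [inner_sub_left, real_inner_smul_left, sum_inner]
  simp only [real_inner_smul_left]

/-- Centring at the sample mean instead of `m` costs one rank-one operator, whose Hilbert–Schmidt
norm is the squared norm of its vector. -/
theorem hsNorm_empCov_sub_le {C : H →L[ℝ] H} (hC : IsHilbertSchmidt C) (m : H)
    {N : ℕ} (hN : 1 ≤ N) (x : ℕ → H) :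
    hsNorm (empCov N x - C) ≤ hsNorm (centeredDeviation C m N x) + ‖sampleMean N x - m‖ ^ 2 := by
  rw [empCov_eq hN x m, sub_right_comm, sub_eq_add_neg _ (InnerProductSpace.rankOne ℝ _ _),
    ← hsNorm_rankOne, ← hsNorm_neg (InnerProductSpace.rankOne ℝ _ _)]
  exact hsNorm_add_le (isHilbertSchmidt_centeredDeviation hC m N x)
    (isHilbertSchmidt_rankOne _).neg

/-! ### Second-moment bounds and `√N`-consistency. -/

variable [MeasurableSpace H] [BorelSpace H] {ι : Type*} [Countable ι]
  (e : HilbertBasis ι ℝ H) {X : ℕ → Ω → H}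

include e in
theorem lintegral_norm_sampleMean_sub_sq_le (hmeas : ∀ n, Measurable (X n))
    (hindep : iIndepFun X μ) (hident : ∀ n, IdentDistrib (X n) (X 0) μ μ)
    (hX : MemLp (X 0) 2 μ) {N : ℕ} (hN : 1 ≤ N) :
    ∫⁻ ω, ENNReal.ofReal (‖sampleMean N (fun n => X n ω) - ∫ ω', X 0 ω' ∂μ‖ ^ 2) ∂μ
      ≤ ENNReal.ofReal (N : ℝ)⁻¹ *
        ∫⁻ ω, ENNReal.ofReal (‖X 0 ω - ∫ ω', X 0 ω' ∂μ‖ ^ 2) ∂μ := by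
  set m := ∫ ω', X 0 ω' ∂μ with hm
  have hY : MemLp (fun ω => X 0 ω - m) 2 μ := hX.sub (memLp_const m)
  have hmeasf : ∀ i, Measurable fun x : H => ⟪x - m, e i⟫_ℝ := fun i =>
    (by fun_prop : Continuous fun x : H => ⟪x - m, e i⟫_ℝ).measurable
  have hmean : ∀ i, ∫ ω, ⟪X 0 ω - m, e i⟫_ℝ ∂μ = 0 := fun i => by
    have h : ∀ ω, ⟪X 0 ω - m, e i⟫_ℝ = ⟪e i, X 0 ω - m⟫_ℝ := fun ω => real_inner_comm _ _
    simp only [h]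
    rw [integral_inner (hY.integrable (by simp)),
      integral_sub (hX.integrable (by simp)) (integrable_const m)]
    simp [hm]
  simp only [ofReal_norm_sq_eq_tsum e]
  rw [lintegral_tsum fun i => ?_, lintegral_tsum fun i => ?_, ← ENNReal.tsum_mul_left]
  · refine ENNReal.tsum_le_tsum fun i => ?_
    have h := lintegral_sq_mean_sub_integral_le hindep hident (hmeasf i) (hY.inner_const (e i)) hN
    simpa only [hmean, sub_zero, sampleMean_sub hN, real_inner_smul_left, sum_inner] using h
  · exact (((hmeasf i).comp (hmeas 0)).pow_const 2).ennreal_ofReal.aemeasurable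
  · simp only [sampleMean_sub hN, real_inner_smul_left, sum_inner]
    exact (((Finset.measurable_sum _ fun n _ =>
      (hmeasf i).comp (hmeas n)).const_mul _).pow_const 2).ennreal_ofReal.aemeasurable

omit [CompleteSpace H] in
theorem measurable_inner_centeredDeviation_sq (hmeas : ∀ n, Measurable (X n)) (C : H →L[ℝ] H)
    (m : H) (N : ℕ) (u v : H) :
    Measurable fun ω =>
      ENNReal.ofReal (⟪centeredDeviation C m N (fun n => X n ω) u, v⟫_ℝ ^ 2) := by
  have hmeasf : ∀ u, Measurable fun x : H => ⟪x - m, u⟫_ℝ := fun u =>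
    (by fun_prop : Continuous fun x : H => ⟪x - m, u⟫_ℝ).measurable
  simp only [inner_centeredDeviation]
  exact (((Finset.measurable_sum _ fun n _ => ((hmeasf u).comp (hmeas n)).mul
    ((hmeasf v).comp (hmeas n))).const_mul _).sub_const _).pow_const 2 |>.ennreal_ofReal

include e in
theorem measurable_hsNorm_centeredDeviation_sq (hmeas : ∀ n, Measurable (X n)) {C : H →L[ℝ] H}
    (hC : IsHilbertSchmidt C) (m : H) (N : ℕ) :
    Measurable fun ω =>
      ENNReal.ofReal (hsNorm (centeredDeviation C m N (fun n => X n ω)) ^ 2) := by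
  simp only [ofReal_hsNorm_sq (isHilbertSchmidt_centeredDeviation hC m N _) e]
  exact Measurable.tsum fun i => Measurable.tsum fun j =>
    measurable_inner_centeredDeviation_sq hmeas C m N _ _

-- Each matrix entry is a centred mean of products of two coordinates. Summing the variance bounds
-- over all entries gives the fourth power of the norm, by Parseval twice.
include e in
theorem lintegral_hsNorm_centeredDeviation_sq_le (hmeas : ∀ n, Measurable (X n))
    (hindep : iIndepFun X μ) (hident : ∀ n, IdentDistrib (X n) (X 0) μ μ)
    (hX : MemLp (X 0) 4 μ) (hC : IsHilbertSchmidt (covOp μ (X 0))) {N : ℕ} (hN : 1 ≤ N) :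
    ∫⁻ ω, ENNReal.ofReal (hsNorm (centeredDeviation (covOp μ (X 0)) (∫ ω', X 0 ω' ∂μ) N
        (fun n => X n ω)) ^ 2) ∂μ
      ≤ ENNReal.ofReal (N : ℝ)⁻¹ *
        ∫⁻ ω, ENNReal.ofReal (‖X 0 ω - ∫ ω', X 0 ω' ∂μ‖ ^ 4) ∂μ := by
  set m := ∫ ω', X 0 ω' ∂μ with hm
  have hY : MemLp (fun ω => X 0 ω - m) 4 μ := hX.sub (memLp_const m)
  have hY2 : MemLp (fun ω => X 0 ω - m) 2 μ := hY.mono_exponent (by norm_num)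
  have hmeasf : ∀ i j, Measurable fun x : H => ⟪x - m, e i⟫_ℝ * ⟪x - m, e j⟫_ℝ := fun i j =>
    (by fun_prop : Continuous fun x : H => ⟪x - m, e i⟫_ℝ * ⟪x - m, e j⟫_ℝ).measurable
  have hL2 : ∀ i j, MemLp (fun ω => ⟪X 0 ω - m, e i⟫_ℝ * ⟪X 0 ω - m, e j⟫_ℝ) 2 μ := fun i j => by
    have hms := ((hmeasf i j).comp (hmeas 0)).aestronglyMeasurable (μ := μ)
    refine (memLp_two_iff_integrable_sq hms).2 ((hY.integrable_norm_pow four_ne_zero).mono'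
      (hms.pow 2) (ae_of_all _ fun ω => ?_))
    -- Cauchy–Schwarz against unit vectors dominates the squared product by the integrable fourth
    -- power.
    have h : ∀ k, |⟪X 0 ω - m, e k⟫_ℝ| ≤ ‖X 0 ω - m‖ := fun k => by
      simpa [e.orthonormal.1 k] using abs_real_inner_le_norm (X 0 ω - m) (e k)
    calc ‖(⟪X 0 ω - m, e i⟫_ℝ * ⟪X 0 ω - m, e j⟫_ℝ) ^ 2‖
        = (|⟪X 0 ω - m, e i⟫_ℝ| * |⟪X 0 ω - m, e j⟫_ℝ|) ^ 2 := by simp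
      _ ≤ (‖X 0 ω - m‖ * ‖X 0 ω - m‖) ^ 2 := by gcongr <;> exact h _
      _ = _ := by ring
  have hnorm : ∀ ω, ENNReal.ofReal (‖X 0 ω - m‖ ^ 4) = ∑' i, ∑' j,
      ENNReal.ofReal ((⟪X 0 ω - m, e i⟫_ℝ * ⟪X 0 ω - m, e j⟫_ℝ) ^ 2) := fun ω => by
    simp only [mul_pow, ENNReal.ofReal_mul (sq_nonneg _)]
    simp only [ENNReal.tsum_mul_left, ENNReal.tsum_mul_right, ← ofReal_norm_sq_eq_tsum e]
    rw [← ENNReal.ofReal_mul (sq_nonneg _)]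
    ring_nf
  have hmeas_sq : ∀ i j, Measurable fun ω =>
      ENNReal.ofReal ((⟪X 0 ω - m, e i⟫_ℝ * ⟪X 0 ω - m, e j⟫_ℝ) ^ 2) := fun i j =>
    (((hmeasf i j).comp (hmeas 0)).pow_const 2).ennreal_ofReal
  simp only [ofReal_hsNorm_sq (isHilbertSchmidt_centeredDeviation hC m N _) e, hnorm]
  rw [lintegral_tsum fun i => (Measurable.tsum fun j =>
      measurable_inner_centeredDeviation_sq hmeas _ _ _ _ _).aemeasurable,
    lintegral_tsum fun i => (Measurable.tsum fun j => hmeas_sq i j).aemeasurable,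
    ← ENNReal.tsum_mul_left]
  refine ENNReal.tsum_le_tsum fun i => ?_
  rw [lintegral_tsum fun j => (measurable_inner_centeredDeviation_sq hmeas _ _ _ _ _).aemeasurable,
    lintegral_tsum fun j => (hmeas_sq i j).aemeasurable, ← ENNReal.tsum_mul_left]
  refine ENNReal.tsum_le_tsum fun j => ?_
  simpa only [inner_centeredDeviation, inner_covOp_apply hY2] using
    lintegral_sq_mean_sub_integral_le hindep hident (hmeasf i j) (hL2 i j) hN

omit [IsProbabilityMeasure μ] in
theorem measure_le_ofReal_div {f : Ω → ℝ} (hf : Measurable fun ω => ENNReal.ofReal (f ω))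
    {K t : ℝ} (ht : 0 < t) (hK : ∫⁻ ω, ENNReal.ofReal (f ω) ∂μ ≤ ENNReal.ofReal K) :
    μ {ω | t ≤ f ω} ≤ ENNReal.ofReal (K / t) := by
  have ht' : ENNReal.ofReal t ≠ 0 := by simpa using ht
  calc μ {ω | t ≤ f ω} ≤ μ {ω | ENNReal.ofReal t ≤ ENNReal.ofReal (f ω)} :=
        measure_mono fun ω hω => ENNReal.ofReal_le_ofReal hω
    _ ≤ (∫⁻ ω, ENNReal.ofReal (f ω) ∂μ) / ENNReal.ofReal t :=
        meas_ge_le_lintegral_div hf.aemeasurable ht' ENNReal.ofReal_ne_top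
    _ ≤ ENNReal.ofReal K / ENNReal.ofReal t := by gcongr
    _ = _ := (ENNReal.ofReal_div_of_pos ht).symm

include e in
/-- The empirical covariance is `√N`-consistent in the Hilbert-Schmidt norm. -/
theorem exists_measure_hsNorm_empCov_sub_le (hmeas : ∀ n, Measurable (X n))
    (hindep : iIndepFun X μ) (hident : ∀ n, IdentDistrib (X n) (X 0) μ μ)
    (hX : MemLp (X 0) 4 μ) (hC : IsHilbertSchmidt (covOp μ (X 0))) {ε : ℝ} (hε : 0 < ε) :
    ∃ M : ℝ, 0 ≤ M ∧ ∀ N : ℕ, 1 ≤ N →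
      μ {ω | M / √(N : ℝ) < hsNorm (empCov N (fun n => X n ω) - covOp μ (X 0))}
        ≤ ENNReal.ofReal ε := by
  set m := ∫ ω', X 0 ω' ∂μ with hm
  have hX2 : MemLp (X 0) 2 μ := hX.mono_exponent (by norm_num)
  have hY : MemLp (fun ω => X 0 ω - m) 4 μ := hX.sub (memLp_const m)
  have hY2 : MemLp (fun ω => X 0 ω - m) 2 μ := hX2.sub (memLp_const m)
  set K₄ := ∫ ω, ‖X 0 ω - m‖ ^ 4 ∂μ with hK₄
  set K₂ := ∫ ω, ‖X 0 ω - m‖ ^ 2 ∂μ with hK₂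
  have hK₄0 : 0 ≤ K₄ := integral_nonneg fun _ => by positivity
  have hK₂0 : 0 ≤ K₂ := integral_nonneg fun _ => by positivity
  have hK₄' := ofReal_integral_eq_lintegral_ofReal (hY.integrable_norm_pow four_ne_zero)
    (ae_of_all _ fun _ => by positivity)
  have hK₂' := ofReal_integral_eq_lintegral_ofReal (hY2.integrable_norm_pow two_ne_zero)
    (ae_of_all _ fun _ => by positivity)
  -- Splitting the threshold in halves, Markov gives `4 K₄ / M²` for the deviation and `2 K₂ / (M
  -- √N)` for the mean correction. The summand 1 ensures `M ≥ 1`, so that one power of `M` can be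
  -- dropped.
  refine ⟨(4 * K₄ + 2 * K₂) / ε + 1, by positivity, fun N hN => ?_⟩
  set M := (4 * K₄ + 2 * K₂) / ε + 1 with hM
  have hM1 : 1 ≤ M := le_add_of_nonneg_left (by positivity)
  have hM0 : 0 < M := by linarith
  have hN1 : (1 : ℝ) ≤ N := by exact_mod_cast hN
  have hs1 : 1 ≤ √(N : ℝ) := Real.one_le_sqrt.2 hN1
  have hs0 : 0 < √(N : ℝ) := by linarith
  have hsN : √(N : ℝ) ^ 2 = N := Real.sq_sqrt (by positivity)
  have h₁ := lintegral_hsNorm_centeredDeviation_sq_le e hmeas hindep hident hX hC hN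
  have h₂ := lintegral_norm_sampleMean_sub_sq_le e hmeas hindep hident hX2 hN
  rw [← hm, ← hK₄', ← hK₄, ← ENNReal.ofReal_mul (by positivity)] at h₁
  rw [← hm, ← hK₂', ← hK₂, ← ENNReal.ofReal_mul (by positivity)] at h₂
  have hm₂ : Measurable fun ω => ENNReal.ofReal (‖sampleMean N (fun n => X n ω) - m‖ ^ 2) := by
    simp only [ofReal_norm_sq_eq_tsum e, sampleMean_sub hN, real_inner_smul_left, sum_inner]
    refine Measurable.tsum fun i => (((Finset.measurable_sum _ fun n _ => ?_).const_mul
      _).pow_const 2).ennreal_ofReal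
    exact (by fun_prop : Continuous fun x : H => ⟪x - m, e i⟫_ℝ).measurable.comp (hmeas n)
  have p₁ := measure_le_ofReal_div (measurable_hsNorm_centeredDeviation_sq e hmeas hC m N)
    (by positivity : 0 < (M / (2 * √(N : ℝ))) ^ 2) h₁
  have p₂ := measure_le_ofReal_div hm₂ (by positivity : 0 < M / (2 * √(N : ℝ))) h₂
  calc _ ≤ μ ({ω | (M / (2 * √(N : ℝ))) ^ 2
            ≤ hsNorm (centeredDeviation (covOp μ (X 0)) m N fun n => X n ω) ^ 2}
          ∪ {ω | M / (2 * √(N : ℝ)) ≤ ‖sampleMean N (fun n => X n ω) - m‖ ^ 2}) := by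
        refine measure_mono fun ω hω => ?_
        rw [Set.mem_ofPred_eq] at hω
        have hle := hsNorm_empCov_sub_le hC m hN fun n => X n ω
        have hhalf : M / √(N : ℝ) = M / (2 * √(N : ℝ)) + M / (2 * √(N : ℝ)) := by
          field_simp; ring
        rcases le_or_gt (M / (2 * √(N : ℝ))) (‖sampleMean N (fun n => X n ω) - m‖ ^ 2) with h | h
        · exact Or.inr h
        · left
          change (M / (2 * √(N : ℝ))) ^ 2 ≤ _
          exact pow_le_pow_left₀ (by positivity) (by linarith) 2
    _ ≤ _ := measure_union_le _ _
    _ ≤ _ := add_le_add p₁ p₂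
    _ ≤ ENNReal.ofReal ε := by
      rw [← ENNReal.ofReal_add (by positivity) (by positivity)]
      refine ENNReal.ofReal_le_ofReal ?_
      have e₁ : (N : ℝ)⁻¹ * K₄ / (M / (2 * √(N : ℝ))) ^ 2 ≤ 4 * K₄ / M := by
        rw [div_pow, mul_pow, hsN]
        have : (N : ℝ)⁻¹ * K₄ / (M ^ 2 / (2 ^ 2 * N)) = 4 * K₄ / M / M := by field_simp; norm_num
        rw [this]
        exact div_le_self (by positivity) hM1
      have e₂ : (N : ℝ)⁻¹ * K₂ / (M / (2 * √(N : ℝ))) ≤ 2 * K₂ / M := by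
        have : (N : ℝ)⁻¹ * K₂ / (M / (2 * √(N : ℝ))) = 2 * K₂ / M / √(N : ℝ) := by
          field_simp
          rw [hsN, mul_comm]
        rw [this]
        exact div_le_self (by positivity) hs1
      have e₃ : (4 * K₄ + 2 * K₂) / M ≤ ε := by
        rw [div_le_iff₀ hM0, hM, mul_add, mul_div_cancel₀ _ hε.ne']
        linarith
      rw [add_div] at e₃
      linarith

end Probability

/-! ### Assembly of the two bounds. -/

theorem theorem1 {H₁ H₂ Ω : Type*}
    [NormedAddCommGroup H₁] [InnerProductSpace ℝ H₁] [CompleteSpace H₁]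
    [TopologicalSpace.SeparableSpace H₁]
    [NormedAddCommGroup H₂] [InnerProductSpace ℝ H₂] [CompleteSpace H₂]
    [TopologicalSpace.SeparableSpace H₂]
    [MeasurableSpace (HilbertTensor H₁ H₂)] [BorelSpace (HilbertTensor H₁ H₂)]
    [MeasurableSpace Ω] (μ : Measure Ω) [IsProbabilityMeasure μ]
    (X : ℕ → Ω → HilbertTensor H₁ H₂)
    (hmeas : ∀ n, Measurable (X n))
    (hindep : iIndepFun X μ)
    (hident : ∀ n, IdentDistrib (X n) (X 0) μ μ)
    (hmoment : MemLp (X 0) 4 μ)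
    (σ : ℕ → ℝ) (A : ℕ → H₁ →L[ℝ] H₁) (B : ℕ → H₂ →L[ℝ] H₂)
    (hSCD : IsSCD (covOp μ (X 0)) σ A B) :
    ∀ ε : ℝ, 0 < ε → ∃ M : ℝ, ∀ R : ℕ, 1 ≤ R → (∀ i < R, σ (i + 1) < σ i) →
      ∀ N : ℕ, 1 ≤ N →
        ∀ Chat : Ω → (HilbertTensor H₁ H₂ →L[ℝ] HilbertTensor H₁ H₂),
          (∀ᵐ ω ∂μ, IsBestRSeparable R (empCov N (fun n => X n ω)) (Chat ω)) →
          μ {ω | √(∑' i : ℕ, σ (R + i) ^ 2)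
                + M * (aConst (covOp μ (X 0)) σ R / √(N : ℝ))
              < hsNorm (Chat ω - covOp μ (X 0))} ≤ ENNReal.ofReal ε := by
  intro ε hε
  have hc₁ := (stdHilbertBasis H₁).countable
  have hc₂ := (stdHilbertBasis H₂).countable
  obtain ⟨M, hM, hbound⟩ := exists_measure_hsNorm_empCov_sub_le (stdTensorBasis H₁ H₂) hmeas
    hindep hident hmoment hSCD.hilbertSchmidt hε
  -- The 2 is that of the deterministic bound, and `M` was chosen before `R`. Almost sure inclusion
  -- of events is enough, so `Chat` need not be measurable.
  refine ⟨2 * M, fun R hR1 hR N hN Chat hbest => (measure_mono_ae ?_).trans (hbound N hN)⟩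
  filter_upwards [hbest] with ω hω hlt
  have ha := hSCD.one_le_aConst hR1 hR
  have hle := hSCD.hsNorm_bestRSeparable_sub_le (isHilbertSchmidt_empCov _ _) hω
  have hMa : M / √(N : ℝ) ≤ M * (aConst (covOp μ (X 0)) σ R / √(N : ℝ)) := by
    rw [← mul_div_assoc]
    gcongr
    exact le_mul_of_one_le_right hM ha
  change _ < _ at hlt
  change _ < _
  linarith
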